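/- Computational model. A randomized real RAM has memory cells $N[0],N[1],\dots$ holding natural numbers and $R[0],R[1],\dots$ holding real numbers. A program is a finite while-program (sequencing, branching, loops; the guards are comparisons $<$ of two natural cells or of two real cells). Its instructions are: constants in $\mathbb N$; addition and truncated subtraction on the natural cells; $+,-,\times,\div$ on the real cells (division by $0$ gives $0$); indirect addressing through natural cells; drawing a uniformly random element of $\{0,\dots,m-1\}$ for $m\ge 1$ held in a natural cell (the result is $0$ if $m=0$); and querying the entry of the input matrix whose row and column are held in two natural cells. Each instruction, each comparison and each unfolding of a sequential composition costs one time step. The program receives $n$, $D$ and $\varepsilon$ in memory and can access the matrix $B$ only by queries. When it halts, its verdict (accept or reject) is read off a fixed memory cell. For a real $n\times n$ matrix $B=(b_{ij})$ (not necessarily symmetric), say that $B$ is positive semidefinite if $\langle x,Bx\rangle=\sum_{i,j}b_{ij}x_ix_j\ge 0$ for all $x\in\mathbb R^n$, and, for $\varepsilon>0$, that $B$ is $\varepsilon$-far from positive semidefinite if there is $x\in\mathbb R^n$ with $\|x\|_\infty\le 1$ and $\langle x,Bx\rangle\le-\varepsilon$. Corollary 4.4. There are a single program $\mathcal A$ and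 two real polynomials $q,t$ in two variables such that, for all $n\ge 1$, all real $D$, all $\varepsilon>0$ and every real $n\times n$ matrix $B$ with $|b_{ij}|\le D/n^2$ for all $i,j$, on input $(n,D,\varepsilon)$ with query access to $B$ the following hold. 1. For every outcome of its random choices, $\mathcal A$ halts within $t(D,1/\varepsilon)$ time steps and makes at most $q(D,1/\varepsilon)$ queries to entries of $B$; these bounds do not depend on $n$. 2. If $B$ is $\varepsilon$-far from positive semidefinite, then $\mathcal A$ rejects with probability greater than $2/3$. 3. If $B$ is positive semidefinite, then $\mathcal A$ accepts with probability greater than $2/3$ (equivalently, it rejects with probability less than $1/3$). -/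

import Mathlib

/-- `B` is positive semidefinite: `⟨x, Bx⟩ ≥ 0` for every real vector `x`.
Symmetry of `B` is not required; for symmetric `B` this is the usual notion. -/
def IsPSD {n : ℕ} (B : Matrix (Fin n) (Fin n) ℝ) : Prop :=
  ∀ x : Fin n → ℝ, 0 ≤ x ⬝ᵥ B.mulVec x

/-- `B` is `ε`-far from positive semidefinite: some `x` with `‖x‖_∞ ≤ 1` has `⟨x, Bx⟩ ≤ -ε`. -/
def IsFarFromPSD {n : ℕ} (ε : ℝ) (B : Matrix (Fin n) (Fin n) ℝ) : Prop :=
  ∃ x : Fin n → ℝ, (∀ i, |x i| ≤ 1) ∧ x ⬝ᵥ B.mulVec x ≤ -ε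

/-! A unit-cost randomized real RAM with oracle access to a real matrix.

The memory has cells `N[0], N[1], …` holding natural numbers and cells `R[0], R[1], …` holding
real numbers.  Programs are finite structured (while-)programs over the instructions below. -/

namespace RealRAM

/-- The basic instructions.  All arguments are literals of the program text: `d`, `a`, `b` are
addresses of memory cells and `c` is a constant.  There is no conversion (such as rounding) from
reals to natural numbers, and there is no multiplication of natural numbers, so the naturals
occurring in a computation of `t` steps have bit length at most linear in `t` plus that of the
initial data. -/
inductive Instr where
  /-- `N[d] := c` -/
  | natConst (d c : ℕ)
  /-- `N[d] := N[a] + N[b]` -/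
  | natAdd (d a b : ℕ)
  /-- `N[d] := max (N[a] - N[b]) 0` -/
  | natSub (d a b : ℕ)
  /-- indirect read `N[d] := N[N[a]]` -/
  | natLoad (d a : ℕ)
  /-- indirect write `N[N[d]] := N[a]` -/
  | natStore (d a : ℕ)
  /-- `N[d] :=` a fresh uniformly random element of `{0, …, N[a] - 1}` (and `0` if `N[a] = 0`) -/
  | natRand (d a : ℕ)
  /-- `R[d] := c` -/
  | realConst (d c : ℕ)
  /-- `R[d] := R[a] + R[b]` -/
  | realAdd (d a b : ℕ)
  /-- `R[d] := R[a] - R[b]` -/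
  | realSub (d a b : ℕ)
  /-- `R[d] := R[a] * R[b]` -/
  | realMul (d a b : ℕ)
  /-- `R[d] := R[a] / R[b]` (and `0` if `R[b] = 0`) -/
  | realDiv (d a b : ℕ)
  /-- indirect read `R[d] := R[N[a]]` -/
  | realLoad (d a : ℕ)
  /-- indirect write `R[N[d]] := R[a]` -/
  | realStore (d a : ℕ)
  /-- oracle query: `R[d] :=` the entry of the matrix in row `N[a]` and column `N[b]` -/
  | query (d a b : ℕ)

/-- The comparisons that may guard a branch or a loop: `N[a] < N[b]` and `R[a] < R[b]`. -/
inductive Test where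
  | natLt (a b : ℕ)
  | realLt (a b : ℕ)

/-- Programs. -/
inductive Cmd where
  | basic (i : Instr)
  | seq (p q : Cmd)
  | ite (t : Test) (p q : Cmd)
  | while (t : Test) (p : Cmd)

/-- The contents of the memory, together with the number of oracle queries made so far (which the
program itself cannot access). -/
@[ext] structure Store where
  nat : ℕ → ℕ
  real : ℕ → ℝ
  queries : ℕ

namespace Store

/-- The store after `N[d] := v`. -/
def setNat (s : Store) (d v : ℕ) : Store := { s with nat := Function.update s.nat d v }

/-- The store after `R[d] := v`. -/
def setReal (s : Store) (d : ℕ) (v : ℝ) : Store :=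
  { s with real := Function.update s.real d v }

end Store

/-- The uniform distribution on `{0, …, m - 1}` (the point mass at `0` if `m = 0`). -/
noncomputable def uniformBelow (m : ℕ) : PMF ℕ :=
  if h : m = 0 then PMF.pure 0
  else PMF.uniformOfFinset (Finset.range m) (Finset.nonempty_range_iff.mpr h)

/-- The entry of `B` with (zero-based) row number `i` and column number `j`; `0` outside `B`. -/
def entry {n : ℕ} (B : Matrix (Fin n) (Fin n) ℝ) (i j : ℕ) : ℝ :=
  if h : i < n ∧ j < n then B ⟨i, h.1⟩ ⟨j, h.2⟩ else 0

/-- The distribution of the store after executing one instruction with oracle `B`. -/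
noncomputable def Instr.exec {n : ℕ} (B : Matrix (Fin n) (Fin n) ℝ) (s : Store) :
    Instr → PMF Store
  | natConst d c => PMF.pure (s.setNat d c)
  | natAdd d a b => PMF.pure (s.setNat d (s.nat a + s.nat b))
  | natSub d a b => PMF.pure (s.setNat d (s.nat a - s.nat b))
  | natLoad d a => PMF.pure (s.setNat d (s.nat (s.nat a)))
  | natStore d a => PMF.pure (s.setNat (s.nat d) (s.nat a))
  | natRand d a => (uniformBelow (s.nat a)).map (fun v => s.setNat d v)
  | realConst d c => PMF.pure (s.setReal d (c : ℝ))
  | realAdd d a b => PMF.pure (s.setReal d (s.real a + s.real b))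
  | realSub d a b => PMF.pure (s.setReal d (s.real a - s.real b))
  | realMul d a b => PMF.pure (s.setReal d (s.real a * s.real b))
  | realDiv d a b => PMF.pure (s.setReal d (s.real a / s.real b))
  | realLoad d a => PMF.pure (s.setReal d (s.real (s.nat a)))
  | realStore d a => PMF.pure (s.setReal (s.nat d) (s.real a))
  | query d a b =>
      PMF.pure { s.setReal d (entry B (s.nat a) (s.nat b)) with queries := s.queries + 1 }

/-- The truth of a comparison in a store. -/
def Test.holds (s : Store) : Test → Prop
  | natLt a b => s.nat a < s.nat b
  | realLt a b => s.real a < s.real b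

/-- A configuration: the list of programs still to be executed, in order, and the store. -/
@[ext] structure Config where
  todo : List Cmd
  store : Store

open Classical in
/-- One step of the computation.  Every instruction and every comparison costs one step, and so
does the unfolding of a sequential composition.  A configuration with nothing left to execute has
halted and does not change any more. -/
noncomputable def step {n : ℕ} (B : Matrix (Fin n) (Fin n) ℝ) : Config → PMF Config
  | ⟨[], s⟩ => PMF.pure ⟨[], s⟩
  | ⟨Cmd.basic i :: K, s⟩ => (i.exec B s).map (fun s' => ⟨K, s'⟩)
  | ⟨Cmd.seq p q :: K, s⟩ => PMF.pure ⟨p :: q :: K, s⟩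
  | ⟨Cmd.ite t p q :: K, s⟩ => PMF.pure ⟨(if t.holds s then p else q) :: K, s⟩
  | ⟨Cmd.while t p :: K, s⟩ =>
      PMF.pure ⟨if t.holds s then p :: Cmd.while t p :: K else K, s⟩

/-- The distribution of the configuration after `T` steps. -/
noncomputable def run {n : ℕ} (B : Matrix (Fin n) (Fin n) ℝ) : ℕ → Config → PMF Config
  | 0, c => PMF.pure c
  | T + 1, c => (step B c).bind (run B T)

/-- The initial configuration of program `A`: the dimension `n` is in `N[0]`, the parameters
`D` and `ε` are in `R[0]` and `R[1]`, and every other cell contains `0`. -/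
def init (A : Cmd) (n : ℕ) (D ε : ℝ) : Config where
  todo := [A]
  store :=
    { nat := fun i => if i = 0 then n else 0
      real := fun i => if i = 0 then D else if i = 1 then ε else 0
      queries := 0 }

namespace Config

/-- The computation has halted. -/
def Halted (c : Config) : Prop := c.todo = []

/-- The computation has halted with verdict "accept", which is `N[0] = 1`. -/
def Accepts (c : Config) : Prop := c.Halted ∧ c.store.nat 0 = 1

/-- The computation has halted with verdict "reject", which is `N[0] ≠ 1`. -/
def Rejects (c : Config) : Prop := c.Halted ∧ c.store.nat 0 ≠ 1

end Config

end RealRAM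

namespace RealRAM

variable {n : ℕ} {B : Matrix (Fin n) (Fin n) ℝ}

/-- From `c` the computation gets to `c'` in exactly `t` steps, with certainty. -/
def Reaches (B : Matrix (Fin n) (Fin n) ℝ) (c : Config) (t : ℕ) (c' : Config) : Prop :=
  ∀ T, run B (t + T) c = run B T c'

theorem Reaches.trans {c c' c'' : Config} {t t' : ℕ} (h : Reaches B c t c')
    (h' : Reaches B c' t' c'') : Reaches B c (t + t') c'' := fun T => by
  rw [add_assoc, h, h']

theorem Reaches.of_step {c c' : Config} (h : step B c = PMF.pure c') : Reaches B c 1 c' :=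
  fun T => by
    rw [add_comm, run, h, PMF.pure_bind]

theorem run_halted (T : ℕ) (s : Store) : run B T ⟨[], s⟩ = PMF.pure ⟨[], s⟩ := by
  induction T with
  | zero => rfl
  | succ T ih => rw [run, step, PMF.pure_bind, ih]

theorem Reaches.run_eq_of_le {c : Config} {s : Store} {t T : ℕ} (h : Reaches B c t ⟨[], s⟩)
    (hT : t ≤ T) : run B T c = PMF.pure ⟨[], s⟩ := by
  obtain ⟨d, rfl⟩ := Nat.exists_eq_add_of_le hT
  rw [h, run_halted]

/-- The effect of a deterministic instruction. -/
noncomputable def Instr.apply (B : Matrix (Fin n) (Fin n) ℝ) (s : Store) : Instr → Store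
  | natConst d c => s.setNat d c
  | natAdd d a b => s.setNat d (s.nat a + s.nat b)
  | natSub d a b => s.setNat d (s.nat a - s.nat b)
  | natLoad d a => s.setNat d (s.nat (s.nat a))
  | natStore d a => s.setNat (s.nat d) (s.nat a)
  | natRand _ _ => s
  | realConst d c => s.setReal d (c : ℝ)
  | realAdd d a b => s.setReal d (s.real a + s.real b)
  | realSub d a b => s.setReal d (s.real a - s.real b)
  | realMul d a b => s.setReal d (s.real a * s.real b)
  | realDiv d a b => s.setReal d (s.real a / s.real b)
  | realLoad d a => s.setReal d (s.real (s.nat a))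
  | realStore d a => s.setReal (s.nat d) (s.real a)
  | query d a b => { s.setReal d (entry B (s.nat a) (s.nat b)) with queries := s.queries + 1 }

/-- The instruction makes no random choice. -/
def Instr.IsDet : Instr → Bool
  | natRand _ _ => false
  | _ => true

theorem Instr.exec_eq_pure (s : Store) {i : Instr} (hi : i.IsDet = true) :
    i.exec B s = PMF.pure (i.apply B s) := by
  cases i <;> first | rfl | simp [Instr.IsDet] at hi

/-- A non-empty sequence of instructions as a program. -/
def block (i : Instr) : List Instr → Cmd
  | [] => Cmd.basic i
  | j :: l => Cmd.seq (Cmd.basic i) (block j l)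

theorem Reaches.basic (s : Store) {i : Instr} (hi : i.IsDet = true) (K : List Cmd) :
    Reaches B ⟨Cmd.basic i :: K, s⟩ 1 ⟨K, i.apply B s⟩ :=
  .of_step (by rw [step, Instr.exec_eq_pure s hi, PMF.pure_map])

theorem Reaches.seq (s : Store) (p q : Cmd) (K : List Cmd) :
    Reaches B ⟨Cmd.seq p q :: K, s⟩ 1 ⟨p :: q :: K, s⟩ :=
  .of_step (by rw [step])

theorem Reaches.block (l : List Instr) : ∀ (i : Instr) (s : Store),
    ((i :: l).all Instr.IsDet) = true → ∀ K : List Cmd,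
    Reaches B ⟨RealRAM.block i l :: K, s⟩ (2 * l.length + 1)
      ⟨K, (i :: l).foldl (Instr.apply B) s⟩ := by
  induction l with
  | nil =>
    intro i s hi K
    exact Reaches.basic s (by simpa using hi) K
  | cons j l ih =>
    intro i s hi K
    rw [List.all_cons, Bool.and_eq_true] at hi
    have := ((Reaches.seq (B := B) s (Cmd.basic i) (RealRAM.block j l) K).trans
      (Reaches.basic s hi.1 _)).trans (ih j (i.apply B s) hi.2 K)
    rwa [show 1 + 1 + (2 * l.length + 1) = 2 * (j :: l).length + 1 by
      rw [List.length_cons]; ring] at this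

/-- Every run of `p` from a store with `P` ends within `t` steps in a uniquely determined store,
which has `Q`. -/
def Triple (B : Matrix (Fin n) (Fin n) ℝ) (P : Store → Prop) (p : Cmd) (t : ℕ)
    (Q : Store → Prop) : Prop :=
  ∀ s, P s → ∃ t' ≤ t, ∃ s', Q s' ∧ ∀ K, Reaches B ⟨p :: K, s⟩ t' ⟨K, s'⟩

namespace Triple

variable {P Q R : Store → Prop} {p q : Cmd} {t t' : ℕ}

theorem consequence {P' Q' : Store → Prop} (h : Triple B P p t Q) (hP : ∀ s, P' s → P s)
    (hQ : ∀ s, Q s → Q' s) (ht : t ≤ t') : Triple B P' p t' Q' := fun s hs => by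
  obtain ⟨u, hu, s', hs', hr⟩ := h s (hP s hs)
  exact ⟨u, hu.trans ht, s', hQ s' hs', hr⟩

theorem seq (h : Triple B P p t Q) (h' : Triple B Q q t' R) :
    Triple B P (Cmd.seq p q) (t + t' + 1) R := fun s hs => by
  obtain ⟨u, hu, s', hs', hr⟩ := h s hs
  obtain ⟨v, hv, s'', hs'', hr'⟩ := h' s' hs'
  exact ⟨1 + u + v, by omega, s'', hs'', fun K =>
    ((Reaches.seq s p q K).trans (hr _)).trans (hr' K)⟩

theorem block {i : Instr} {l : List Instr} (hdet : ((i :: l).all Instr.IsDet) = true)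
    (h : ∀ s, P s → Q ((i :: l).foldl (Instr.apply B) s)) :
    Triple B P (RealRAM.block i l) (2 * l.length + 1) Q := fun s hs =>
  ⟨_, le_rfl, _, h s hs, fun K => Reaches.block l i s hdet K⟩

theorem ite {c : Test} (h : Triple B (fun s => P s ∧ c.holds s) p t Q)
    (h' : Triple B (fun s => P s ∧ ¬ c.holds s) q t Q) :
    Triple B P (Cmd.ite c p q) (t + 1) Q := fun s hs => by
  by_cases hc : c.holds s
  · obtain ⟨u, hu, s', hs', hr⟩ := h s ⟨hs, hc⟩
    exact ⟨1 + u, by omega, s', hs', fun K =>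
      (Reaches.of_step (by rw [step, if_pos hc])).trans (hr K)⟩
  · obtain ⟨u, hu, s', hs', hr⟩ := h' s ⟨hs, hc⟩
    exact ⟨1 + u, by omega, s', hs', fun K =>
      (Reaches.of_step (by rw [step, if_neg hc])).trans (hr K)⟩

theorem while_countdown {c : Test} (I : ℕ → Store → Prop) (k : ℕ)
    (hc : ∀ m s, m ≤ k → I m s → (c.holds s ↔ 0 < m))
    (hp : ∀ m < k, Triple B (I (m + 1)) p t (I m)) :
    Triple B (I k) (Cmd.while c p) (k * (t + 1) + 1) (I 0) := by
  induction k with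
  | zero =>
    intro s hs
    refine ⟨1, by omega, s, hs, fun K => Reaches.of_step ?_⟩
    rw [step, if_neg ((hc 0 s le_rfl hs).not.2 (lt_irrefl 0))]
  | succ k ih =>
    intro s hs
    obtain ⟨u, hu, s', hs', hr⟩ := hp k (Nat.lt_succ_self k) s hs
    obtain ⟨v, hv, s'', hs'', hr'⟩ := ih (fun m s hm => hc m s (hm.trans (Nat.le_succ k)))
      (fun m hm => hp m (hm.trans (Nat.lt_succ_self k))) s' hs'
    refine ⟨1 + u + v, by rw [Nat.succ_mul]; omega, s'', hs'', fun K => ?_⟩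
    refine (Reaches.trans (Reaches.of_step ?_) (hr _)).trans (hr' K)
    rw [step, if_pos ((hc (k + 1) s le_rfl hs).2 (Nat.succ_pos k))]

theorem while_countup {c : Test} (I : ℕ → Store → Prop) (k : ℕ)
    (hc : ∀ m s, m ≤ k → I m s → (c.holds s ↔ m < k))
    (hp : ∀ m < k, Triple B (I m) p t (I (m + 1))) :
    Triple B (I 0) (Cmd.while c p) (k * (t + 1) + 1) (I k) := by
  have := while_countdown (B := B) (p := p) (t := t) (c := c) (fun m => I (k - m)) k
    (fun m s hm hI => by rw [hc _ s (Nat.sub_le k m) hI]; omega)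
    (fun m hm => by
      have h := hp (k - (m + 1)) (by omega)
      rwa [show k - (m + 1) + 1 = k - m by omega] at h)
  simpa using this

end Triple

end RealRAM

section

open Finset

/-- The form `∑ M i j x i x j` over the indices below `p` is nonnegative. -/
def PsdOn (p : ℕ) (M : ℕ → ℕ → ℝ) : Prop :=
  ∀ x : ℕ → ℝ, 0 ≤ ∑ i ∈ range p, ∑ j ∈ range p, M i j * x i * x j

/-- Eliminate index `p` from the entries with both indices below `p`. -/
noncomputable def schur (p : ℕ) (M : ℕ → ℕ → ℝ) (i j : ℕ) : ℝ :=
  if i < p ∧ j < p then M i j - M p j * (M i p / M p p) else M i j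

theorem schur_symm {p : ℕ} {M : ℕ → ℕ → ℝ} (hM : ∀ i j, M i j = M j i) (i j : ℕ) :
    schur p M i j = schur p M j i := by
  unfold schur
  simp only [and_comm (a := i < p)]
  rw [hM i j, hM p j, hM i p]
  split_ifs <;> ring

theorem psdOn_zero (M : ℕ → ℕ → ℝ) : PsdOn 0 M := fun x => by simp

theorem form_succ {p : ℕ} {M : ℕ → ℕ → ℝ} (hM : ∀ i j, M i j = M j i) (x : ℕ → ℝ) :
    ∑ i ∈ range (p + 1), ∑ j ∈ range (p + 1), M i j * x i * x j =
      (∑ i ∈ range p, ∑ j ∈ range p, M i j * x i * x j) +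
        2 * x p * (∑ i ∈ range p, M p i * x i) + M p p * x p ^ 2 := by
  simp only [sum_range_succ, sum_add_distrib]
  have h : ∑ i ∈ range p, M i p * x i * x p = x p * ∑ i ∈ range p, M p i * x i := by
    rw [mul_sum]
    exact sum_congr rfl fun i _ => by rw [hM i p]; ring
  have h' : ∑ i ∈ range p, M p i * x p * x i = x p * ∑ i ∈ range p, M p i * x i := by
    rw [mul_sum]
    exact sum_congr rfl fun i _ => by ring
  rw [h, h']
  ring

theorem form_schur {p : ℕ} {M : ℕ → ℕ → ℝ} (hM : ∀ i j, M i j = M j i) (x : ℕ → ℝ) :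
    ∑ i ∈ range p, ∑ j ∈ range p, schur p M i j * x i * x j =
      (∑ i ∈ range p, ∑ j ∈ range p, M i j * x i * x j) -
        (∑ i ∈ range p, M p i * x i) ^ 2 / M p p := by
  rw [sq, sum_mul_sum, sum_div, ← sum_sub_distrib]
  refine sum_congr rfl fun i hi => ?_
  rw [sum_div, ← sum_sub_distrib]
  refine sum_congr rfl fun j hj => ?_
  rw [schur, if_pos ⟨mem_range.1 hi, mem_range.1 hj⟩, hM i p]
  ring

theorem PsdOn.apply_single {p : ℕ} {M : ℕ → ℕ → ℝ} (h : PsdOn p M) {i : ℕ} (hi : i < p) :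
    0 ≤ M i i := by
  simpa [Pi.single_apply, hi] using h (Pi.single i 1)

theorem PsdOn.apply_succ {p : ℕ} {M : ℕ → ℕ → ℝ} (hM : ∀ i j, M i j = M j i)
    (h : PsdOn (p + 1) M) (x : ℕ → ℝ) (v : ℝ) :
    0 ≤ (∑ i ∈ range p, ∑ j ∈ range p, M i j * x i * x j) +
        2 * v * (∑ i ∈ range p, M p i * x i) + M p p * v ^ 2 := by
  have h1 := h (Function.update x p v)
  have e : ∀ j ∈ range p, Function.update x p v j = x j := fun j hj =>
    Function.update_of_ne (mem_range.1 hj).ne _ _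
  have e1 : ∑ i ∈ range p, ∑ j ∈ range p,
      M i j * Function.update x p v i * Function.update x p v j =
        ∑ i ∈ range p, ∑ j ∈ range p, M i j * x i * x j :=
    sum_congr rfl fun i hi => sum_congr rfl fun j hj => by rw [e i hi, e j hj]
  have e2 : ∑ i ∈ range p, M p i * Function.update x p v i = ∑ i ∈ range p, M p i * x i :=
    sum_congr rfl fun i hi => by rw [e i hi]
  rwa [form_succ hM, e1, e2, Function.update_self] at h1

theorem PsdOn.apply_pair {p : ℕ} {M : ℕ → ℕ → ℝ} (hM : ∀ i j, M i j = M j i)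
    (h : PsdOn (p + 1) M) {i : ℕ} (hi : i < p) (u v : ℝ) :
    0 ≤ M i i * u ^ 2 + 2 * u * v * M p i + M p p * v ^ 2 := by
  have := h.apply_succ hM (Pi.single i u) v
  simp [Pi.single_apply, hi] at this
  linarith

theorem psdOn_succ_iff {p : ℕ} {M : ℕ → ℕ → ℝ} (hM : ∀ i j, M i j = M j i) :
    PsdOn (p + 1) M ↔
      (0 ≤ M p p ∧ ∀ i < p, M p i * M i p ≤ M p p * M i i) ∧ PsdOn p (schur p M) := by
  constructor
  · intro h
    have hpp := h.apply_single (Nat.lt_succ_self p)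
    refine ⟨⟨hpp, fun i hi => ?_⟩, fun x => ?_⟩
    · have hii := h.apply_single (hi.trans (Nat.lt_succ_self p))
      have key := fun t : ℝ => h.apply_pair hM hi t 1
      rw [hM i p]
      have := discrim_le_zero (a := M i i) (b := 2 * M p i) (c := M p p)
        fun t => by have := key t; nlinarith
      rw [discrim] at this
      nlinarith
    · have h1 := h.apply_succ hM x (-(∑ i ∈ range p, M p i * x i) / M p p)
      rw [form_schur hM]
      rcases hpp.eq_or_lt with h0 | h0
      · simpa [← h0] using h1
      · convert h1 using 1
        field_simp
        ring
  · rintro ⟨⟨hpp, hi⟩, h⟩ x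
    have h1 := h x
    rw [form_schur hM] at h1
    rw [form_succ hM]
    rcases hpp.eq_or_lt with h0 | h0
    · have : ∑ i ∈ range p, M p i * x i = 0 := sum_eq_zero fun i hip => by
        have := hi i (mem_range.1 hip)
        rw [hM i p, ← h0, zero_mul] at this
        rw [mul_self_eq_zero.1 (le_antisymm this (mul_self_nonneg _)), zero_mul]
      rw [this, ← h0] at h1 ⊢
      simpa using h1
    · have : 0 ≤ (M p p * x p + ∑ i ∈ range p, M p i * x i) ^ 2 / M p p := by positivity
      have e : (M p p * x p + ∑ i ∈ range p, M p i * x i) ^ 2 / M p p =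
        M p p * x p ^ 2 + 2 * x p * (∑ i ∈ range p, M p i * x i) +
          (∑ i ∈ range p, M p i * x i) ^ 2 / M p p := by
        field_simp
        ring
      linarith

theorem sum_sum_update {ι κ : Type*} [Fintype ι] [Fintype κ] [DecidableEq κ] (a : κ)
    (F : (κ → ι) → ℝ) :
    ∑ s, ∑ i, F (Function.update s a i) = Fintype.card ι * ∑ s, F s := by
  rw [← Fintype.sum_prod_type' (f := fun s i => F (Function.update s a i))]
  have e : Function.Involutive
      (fun q : (κ → ι) × ι => (Function.update q.1 a q.2, q.1 a)) := fun q => by simp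
  rw [← Equiv.sum_comp e.toPerm]
  simp [Fintype.sum_prod_type, Function.Involutive.toPerm, mul_sum]

theorem sum_mul_eq_zero {ι κ : Type*} [Fintype ι] [Fintype κ] [DecidableEq κ]
    {g : ι → ι → ℝ} (hg : ∑ i, ∑ j, g i j = 0) {a b c d : κ} (hab : a ≠ b) (hac : a ≠ c)
    (had : a ≠ d) (hbc : b ≠ c) (hbd : b ≠ d) :
    ∑ s : κ → ι, g (s a) (s b) * g (s c) (s d) = 0 := by
  rcases isEmpty_or_nonempty ι with hι | hι
  · exact sum_eq_zero fun s _ => (hι.false (s a)).elim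
  have h1 := sum_sum_update a fun s : κ → ι => g (s a) (s b) * g (s c) (s d)
  have h2 := sum_sum_update b fun s : κ → ι =>
    ∑ i, g (Function.update s a i a) (Function.update s a i b) *
      g (Function.update s a i c) (Function.update s a i d)
  have h3 : ∀ s : κ → ι, ∑ j, ∑ i,
      g (Function.update (Function.update s b j) a i a)
        (Function.update (Function.update s b j) a i b) *
      g (Function.update (Function.update s b j) a i c)
        (Function.update (Function.update s b j) a i d) = 0 := fun s => by
    simp only [Function.update_self, Function.update_of_ne hab.symm, Function.update_of_ne hac.symm,
      Function.update_of_ne had.symm, Function.update_of_ne hbc.symm, Function.update_of_ne hbd.symm]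
    simp only [← sum_mul]
    rw [sum_comm, hg, zero_mul]
  simp only [h3, sum_const_zero] at h2
  rw [h1] at h2
  have : (Fintype.card ι : ℝ) ≠ 0 := by exact_mod_cast Fintype.card_ne_zero
  simpa [this] using h2.symm

theorem sum_sq_sum_le {ι : Type*} [Fintype ι] (K : ℕ) {g : ι → ι → ℝ} {C : ℝ}
    (hg : ∑ i, ∑ j, g i j = 0) (hC : ∀ i j, |g i j| ≤ C) :
    ∑ s : Fin K → ι, (∑ a, ∑ b, g (s a) (s b)) ^ 2 ≤
      5 * K ^ 3 * C ^ 2 * (Fintype.card ι : ℝ) ^ K := by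
  have hterm : ∀ a b c d : Fin K, ∑ s : Fin K → ι, g (s a) (s b) * g (s c) (s d) ≤
      C ^ 2 * (Fintype.card ι : ℝ) ^ K *
        ((if a = b then 1 else 0) + (if a = c then 1 else 0) + (if a = d then 1 else 0) +
          (if b = c then 1 else 0) + (if b = d then 1 else 0)) := by
    intro a b c d
    by_cases h : a ≠ b ∧ a ≠ c ∧ a ≠ d ∧ b ≠ c ∧ b ≠ d
    · rw [sum_mul_eq_zero hg h.1 h.2.1 h.2.2.1 h.2.2.2.1 h.2.2.2.2]
      positivity
    · have h1 : ∑ s : Fin K → ι, g (s a) (s b) * g (s c) (s d) ≤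
          C ^ 2 * (Fintype.card ι : ℝ) ^ K := by
        have : ∀ s ∈ (univ : Finset (Fin K → ι)), g (s a) (s b) * g (s c) (s d) ≤ C ^ 2 :=
          fun s _ => by
            refine (le_abs_self _).trans ?_
            rw [abs_mul, sq]
            exact mul_le_mul (hC _ _) (hC _ _) (abs_nonneg _) ((abs_nonneg _).trans (hC (s a) (s b)))
        refine (sum_le_card_nsmul _ _ _ this).trans_eq ?_
        simp [mul_comm]
      refine h1.trans (le_mul_of_one_le_right (by positivity) ?_)
      by_contra hlt
      apply h
      refine ⟨?_, ?_, ?_, ?_, ?_⟩ <;>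
      · intro e
        apply hlt
        rw [if_pos e]
        have : ∀ p : Prop, ∀ _ : Decidable p, (0 : ℝ) ≤ if p then 1 else 0 := fun p _ => by
          split_ifs <;> norm_num
        have h1 := this (a = b) inferInstance
        have h2 := this (a = c) inferInstance
        have h3 := this (a = d) inferInstance
        have h4 := this (b = c) inferInstance
        have h5 := this (b = d) inferInstance
        linarith
  have hexp : ∑ s : Fin K → ι, (∑ a, ∑ b, g (s a) (s b)) ^ 2 =
      ∑ a, ∑ b, ∑ c, ∑ d, ∑ s : Fin K → ι, g (s a) (s b) * g (s c) (s d) := by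
    have : ∀ s : Fin K → ι, (∑ a, ∑ b, g (s a) (s b)) ^ 2 =
        ∑ a, ∑ b, ∑ c, ∑ d, g (s a) (s b) * g (s c) (s d) := fun s => by
      rw [sq, sum_mul]
      refine sum_congr rfl fun a _ => ?_
      rw [sum_mul]
      refine sum_congr rfl fun b _ => ?_
      rw [mul_sum]
      exact sum_congr rfl fun c _ => by rw [mul_sum]
    simp only [this]
    rw [sum_comm]
    refine sum_congr rfl fun a _ => ?_
    rw [sum_comm]
    refine sum_congr rfl fun b _ => ?_
    rw [sum_comm]
    exact sum_congr rfl fun c _ => sum_comm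
  rw [hexp]
  refine (sum_le_sum fun a _ => sum_le_sum fun b _ => sum_le_sum fun c _ => sum_le_sum fun d _ =>
    hterm a b c d).trans_eq ?_
  simp only [← mul_sum, sum_add_distrib, sum_ite_eq, sum_const, card_univ, Fintype.card_fin,
    mem_univ, if_true, nsmul_eq_mul, mul_one]
  ring

namespace RealRAM

/-- The symmetrised matrix of entries of `B` at the positions `σ 0, σ 1, …`. -/
noncomputable def sampleMatrix {n : ℕ} (B : Matrix (Fin n) (Fin n) ℝ) (σ : ℕ → ℕ) (a b : ℕ) : ℝ :=
  entry B (σ a) (σ b) + entry B (σ b) (σ a)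

/-- Extend a finite sequence of row numbers by zeros. -/
def extendSample {n K : ℕ} (s : Fin K → Fin n) (a : ℕ) : ℕ := if h : a < K then s ⟨a, h⟩ else 0

theorem sampleMatrix_symm {n : ℕ} (B : Matrix (Fin n) (Fin n) ℝ) (σ : ℕ → ℕ) (a b : ℕ) :
    sampleMatrix B σ a b = sampleMatrix B σ b a := add_comm _ _

theorem form_sampleMatrix {n K : ℕ} (B : Matrix (Fin n) (Fin n) ℝ) (s : Fin K → Fin n)
    (y : ℕ → ℝ) :
    ∑ a ∈ range K, ∑ b ∈ range K, sampleMatrix B (extendSample s) a b * y a * y b =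
      2 * ∑ a : Fin K, ∑ b : Fin K, B (s a) (s b) * y a * y b := by
  simp only [sum_range, sampleMatrix, extendSample, entry, Fin.is_lt, dif_pos, true_and, add_mul,
    sum_add_distrib]
  rw [two_mul]
  congr 1
  rw [sum_comm]
  exact sum_congr rfl fun a _ => sum_congr rfl fun b _ => by ring

theorem dotProduct_mulVec_eq_sum {n : ℕ} (B : Matrix (Fin n) (Fin n) ℝ) (x : Fin n → ℝ) :
    x ⬝ᵥ B.mulVec x = ∑ i, ∑ j, B i j * x i * x j := by
  simp only [dotProduct, Matrix.mulVec, mul_sum]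
  exact sum_congr rfl fun i _ => sum_congr rfl fun j _ => by ring

theorem psdOn_sampleMatrix {n K : ℕ} {B : Matrix (Fin n) (Fin n) ℝ} (hB : IsPSD B)
    (s : Fin K → Fin n) : PsdOn K (sampleMatrix B (extendSample s)) := fun y => by
  rw [form_sampleMatrix]
  have h := hB fun i => ∑ a : Fin K, if s a = i then y a else 0
  rw [dotProduct_mulVec_eq_sum] at h
  have e : ∑ i, ∑ j, B i j * (∑ a : Fin K, if s a = i then y a else 0) *
      (∑ a : Fin K, if s a = j then y a else 0) = ∑ a : Fin K, ∑ b : Fin K,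
        B (s a) (s b) * y a * y b := by
    have : ∀ i j, B i j * (∑ a : Fin K, if s a = i then y a else 0) *
        (∑ a : Fin K, if s a = j then y a else 0) = ∑ a : Fin K, ∑ b : Fin K,
          if s a = i then if s b = j then B i j * y a * y b else 0 else 0 := fun i j => by
      rw [mul_assoc, sum_mul_sum, mul_sum]
      refine sum_congr rfl fun a _ => ?_
      rw [mul_sum]
      exact sum_congr rfl fun b _ => by split_ifs <;> ring
    simp only [this]
    calc _ = ∑ i, ∑ a : Fin K, ∑ j, ∑ b : Fin K,
          (if s a = i then if s b = j then B i j * y a * y b else 0 else 0) :=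
            sum_congr rfl fun i _ => sum_comm
      _ = ∑ a : Fin K, ∑ i, ∑ j, ∑ b : Fin K,
          (if s a = i then if s b = j then B i j * y a * y b else 0 else 0) := sum_comm
      _ = ∑ a : Fin K, ∑ i, ∑ b : Fin K, ∑ j,
          (if s a = i then if s b = j then B i j * y a * y b else 0 else 0) :=
            sum_congr rfl fun a _ => sum_congr rfl fun i _ => sum_comm
      _ = ∑ a : Fin K, ∑ b : Fin K, ∑ i, ∑ j,
          (if s a = i then if s b = j then B i j * y a * y b else 0 else 0) :=
            sum_congr rfl fun a _ => sum_comm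
      _ = _ := sum_congr rfl fun a _ => sum_congr rfl fun b _ => by
            simp [sum_ite_irrel]
  rw [e] at h
  linarith

open Classical in
theorem card_psdOn_sampleMatrix_lt {n K : ℕ} {D ε : ℝ} {B : Matrix (Fin n) (Fin n) ℝ}
    (hn : 0 < n) (hε : 0 < ε) (hB : ∀ i j, |B i j| ≤ D / (n : ℝ) ^ 2)
    (hfar : IsFarFromPSD ε B) (hK : 60 * D ^ 2 / ε ^ 2 < K) :
    3 * #{s : Fin K → Fin n | PsdOn K (sampleMatrix B (extendSample s))} < n ^ K := by
  obtain ⟨x, hx, hm⟩ := hfar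
  rw [dotProduct_mulVec_eq_sum] at hm
  set m := ∑ i, ∑ j, B i j * x i * x j with hmdef
  have hn' : (0 : ℝ) < n := by exact_mod_cast hn
  have hbound : ∀ i j, |(n : ℝ) ^ 2 * (B i j * x i * x j)| ≤ D := fun i j => by
    rw [abs_mul, abs_mul, abs_mul, abs_of_pos (by positivity : (0 : ℝ) < (n : ℝ) ^ 2)]
    have h1 : |B i j| * |x i| * |x j| ≤ D / (n : ℝ) ^ 2 := by
      have h2 : |B i j| * |x i| ≤ |B i j| := mul_le_of_le_one_right (abs_nonneg _) (hx i)
      exact (mul_le_of_le_one_right (by positivity) (hx j)).trans (h2.trans (hB i j))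
    calc _ ≤ (n : ℝ) ^ 2 * (D / (n : ℝ) ^ 2) := by gcongr
      _ = D := by field_simp
  have hmD : |m| ≤ D := by
    have : (n : ℝ) ^ 2 * |m| ≤ (n : ℝ) ^ 2 * D := by
      rw [← abs_of_pos (by positivity : (0 : ℝ) < (n : ℝ) ^ 2), ← abs_mul, hmdef, mul_sum]
      refine (abs_sum_le_sum_abs _ _).trans ?_
      calc _ ≤ ∑ i : Fin n, ∑ j : Fin n, D := sum_le_sum fun i _ => by
            rw [mul_sum]
            exact (abs_sum_le_sum_abs _ _).trans (sum_le_sum fun j _ => hbound i j)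
        _ = _ := by simp [abs_of_pos hn']; ring
    exact le_of_mul_le_mul_left this (by positivity)
  let g : Fin n → Fin n → ℝ := fun i j => (n : ℝ) ^ 2 * (B i j * x i * x j) - m
  have hg0 : ∑ i, ∑ j, g i j = 0 := by
    simp only [g, sum_sub_distrib, ← mul_sum, ← hmdef]
    simp
    ring
  have hgC : ∀ i j, |g i j| ≤ 2 * D := fun i j =>
    (abs_sub _ _).trans (by linarith [hbound i j])
  have hsq := sum_sq_sum_le K hg0 hgC
  rw [Fintype.card_fin] at hsq
  set S : Finset (Fin K → Fin n) := {s | PsdOn K (sampleMatrix B (extendSample s))} with hS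
  have hK0 : (0 : ℝ) < K := lt_of_le_of_lt (by positivity) hK
  have hlow : ∀ s ∈ S, ((K : ℝ) ^ 2 * ε) ^ 2 ≤ (∑ a, ∑ b, g (s a) (s b)) ^ 2 := fun s hs => by
    have h := (mem_filter.1 hs).2 fun a => if h : a < K then x (s ⟨a, h⟩) else 0
    rw [form_sampleMatrix] at h
    simp only [Fin.is_lt, dif_pos, Fin.eta] at h
    have hZ : ∑ a, ∑ b, g (s a) (s b) =
        (n : ℝ) ^ 2 * (∑ a, ∑ b, B (s a) (s b) * x (s a) * x (s b)) - (K : ℝ) ^ 2 * m := by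
      simp only [g, sum_sub_distrib, ← mul_sum]
      simp
      ring
    refine pow_le_pow_left₀ (by positivity) ?_ 2
    rw [hZ]
    have : 0 ≤ (n : ℝ) ^ 2 * (∑ a, ∑ b, B (s a) (s b) * x (s a) * x (s b)) :=
      mul_nonneg (by positivity) (by linarith)
    nlinarith [mul_le_mul_of_nonneg_left hm (by positivity : (0 : ℝ) ≤ (K : ℝ) ^ 2)]
  have hcheb : #S * ((K : ℝ) ^ 2 * ε) ^ 2 ≤ 5 * K ^ 3 * (2 * D) ^ 2 * (n : ℝ) ^ K := by
    rw [← nsmul_eq_mul]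
    exact (card_nsmul_le_sum _ _ _ hlow).trans
      ((sum_le_sum_of_subset_of_nonneg (subset_univ _) fun _ _ _ => sq_nonneg _).trans hsq)
  have h1 : #S * (K * ε ^ 2) ≤ 20 * D ^ 2 * (n : ℝ) ^ K := by
    have h3 : (0 : ℝ) < (K : ℝ) ^ 3 := by positivity
    refine le_of_mul_le_mul_left ?_ h3
    linarith
  rw [div_lt_iff₀ (by positivity)] at hK
  have hnK : (0 : ℝ) < (n : ℝ) ^ K := by positivity
  have h2 : (K * ε ^ 2) * (3 * #S) < (K * ε ^ 2) * (n : ℝ) ^ K := by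
    have := mul_lt_mul_of_pos_right hK hnK
    linarith
  exact_mod_cast lt_of_mul_lt_mul_left h2 (by positivity)

end RealRAM

end

namespace RealRAM

open Instr Cmd Test

variable {n : ℕ} {B : Matrix (Fin n) (Fin n) ℝ}

/-- `R[20 + a * K + b] = F a b` for all `a, b < K`. -/
def MatrixAt (K : ℕ) (F : ℕ → ℕ → ℝ) (s : Store) : Prop :=
  ∀ a < K, ∀ b < K, s.real (20 + a * K + b) = F a b

theorem address_inj {K a b i j : ℕ} (hb : b < K) (hj : j < K) :
    20 + a * K + b = 20 + i * K + j ↔ a = i ∧ b = j := by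
  refine ⟨fun h => ?_, by rintro ⟨rfl, rfl⟩; rfl⟩
  have h' : b + K * a = j + K * i := by rw [mul_comm K, mul_comm K]; omega
  have hK : 0 < K := by omega
  have h1 := congrArg (· / K) h'
  have h2 := congrArg (· % K) h'
  simp only [Nat.add_mul_div_left _ _ hK, Nat.div_eq_of_lt hb, Nat.div_eq_of_lt hj,
    Nat.add_mul_mod_self_left, Nat.mod_eq_of_lt hb, Nat.mod_eq_of_lt hj] at h1 h2
  omega

/-- Query the entries at positions `(N[20 + i], N[20 + j])` and `(N[20 + j], N[20 + i])` and write
their sum to `R[N[3]]`, where `i = N[4]` and `j = N[5]`. -/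
def fillEntry : Cmd :=
  block (natConst 9 20) [natAdd 10 9 4, natAdd 11 9 5, natLoad 10 10, natLoad 11 11,
    query 5 10 11, query 6 11 10, realAdd 5 5 6, realStore 3 5, natAdd 3 3 2, natAdd 5 5 2]

/-- Write the symmetrised sample matrix to `R[20], R[21], …`. -/
def fillMatrix : Cmd :=
  Cmd.while (natLt 4 1) (seq (seq (block (natConst 5 0) []) (Cmd.while (natLt 5 1) fillEntry))
    (block (natAdd 4 4 2) []))

/-- The store when the first `i` rows and the first `j` entries of row `i` are written. -/
def FillInv (B : Matrix (Fin n) (Fin n) ℝ) (K : ℕ) (σ : ℕ → ℕ) (i j : ℕ) (s : Store) : Prop :=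
  s.nat 1 = K ∧ s.nat 2 = 1 ∧ s.nat 3 = 20 + i * K + j ∧ s.nat 4 = i ∧ s.nat 5 = j ∧
    (∀ a < K, s.nat (20 + a) = σ a) ∧ s.queries = 2 * (i * K + j) ∧
    ∀ a < K, ∀ b < K, a < i ∨ a = i ∧ b < j → s.real (20 + a * K + b) = sampleMatrix B σ a b

theorem address_ne (x : ℕ) {c : ℕ} (hc : c < 20) : 20 + x ≠ c := by omega

theorem address_ne' (x y : ℕ) {c : ℕ} (hc : c < 20) : 20 + x + y ≠ c := by omega

theorem ne_address' (x y : ℕ) {c : ℕ} (hc : c < 20) : c ≠ 20 + x + y := by omega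

theorem triple_fillEntry {K : ℕ} {σ : ℕ → ℕ} {i j : ℕ} (hi : i < K) (hj : j < K) :
    Triple B (FillInv B K σ i j) fillEntry 21 (FillInv B K σ i (j + 1)) := by
  refine Triple.block (by rfl) ?_
  rintro s ⟨h1, h2, h3, h4, h5, hσ, hq, hM⟩
  have hσi := hσ i hi
  have hσj := hσ j hj
  refine ⟨?_, ?_, ?_, ?_, ?_, fun a ha => ?_, ?_, fun a ha b hb hab => ?_⟩
  all_goals
    simp [Instr.apply, Store.setNat, Store.setReal, Function.update_apply, address_ne,
      address_ne', *]
  · ring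
  · ring
  · simp only [address_inj hb hj]
    split_ifs with h
    · rw [h.1, h.2, sampleMatrix]
    · exact hM a ha b hb (by omega)

theorem triple_fillMatrix {K : ℕ} {σ : ℕ → ℕ} :
    Triple B (fun s => ∃ j, FillInv B K σ 0 0 { s with nat := Function.update s.nat 5 j })
      fillMatrix (K * (22 * K + 6) + 1)
      (fun s => s.nat 1 = K ∧ s.nat 2 = 1 ∧ s.nat 3 = 20 + K * K ∧ s.queries = 2 * (K * K) ∧
        MatrixAt K (sampleMatrix B σ) s) := by
  let I : ℕ → Store → Prop := fun i s =>
    ∃ j, FillInv B K σ i 0 { s with nat := Function.update s.nat 5 j }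
  have hbody : ∀ i < K, Triple B (I i)
      (seq (seq (block (natConst 5 0) []) (Cmd.while (natLt 5 1) fillEntry))
        (block (natAdd 4 4 2) [])) (22 * K + 5) (I (i + 1)) := by
    intro i hi
    have h1 : Triple B (I i) (block (natConst 5 0) []) 1 (FillInv B K σ i 0) := by
      refine Triple.block (by rfl) ?_
      rintro s ⟨j, h1, h2, h3, h4, h5, hσ, hq, hM⟩
      simp [address_ne] at h1 h2 h3 h4 h5 hσ hq hM
      refine ⟨?_, ?_, ?_, ?_, ?_, fun a ha => ?_, ?_, fun a ha b hb hab => ?_⟩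
      all_goals
        simp [Instr.apply, Store.setNat, address_ne, *]
      exact hM a ha b hb (by omega)
    have h2 : Triple B (FillInv B K σ i 0) (Cmd.while (natLt 5 1) fillEntry)
        (K * (21 + 1) + 1) (FillInv B K σ i K) :=
      Triple.while_countup (FillInv B K σ i) K
        (fun m s _ hs => by simp [Test.holds, hs.1, hs.2.2.2.2.1])
        fun m hm => triple_fillEntry hi hm
    have h3 : Triple B (FillInv B K σ i K) (block (natAdd 4 4 2) []) 1 (I (i + 1)) := by
      refine Triple.block (by rfl) ?_
      rintro s ⟨h1, h2, h3, h4, h5, hσ, hq, hM⟩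
      refine ⟨0, ?_, ?_, ?_, ?_, ?_, fun a ha => ?_, ?_, fun a ha b hb hab => ?_⟩
      all_goals
        simp [Instr.apply, Store.setNat, address_ne, *]
      · ring
      · ring
      · exact hM a ha b hb (by omega)
    exact ((h1.seq h2).seq h3).consequence (fun _ h => h) (fun _ h => h) (by omega)
  refine (Triple.while_countup I K (fun m s _ hs => ?_) hbody).consequence (fun _ h => h) ?_
    (by rfl)
  · obtain ⟨j, h1, h2, h3, h4, h5⟩ := hs
    simp at h1 h4
    simp [Test.holds, h1, h4]
  · rintro s ⟨j, h1, h2, h3, h4, h5, hσ, hq, hM⟩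
    simp at h1 h2 h3 hq hM
    exact ⟨h1, h2, h3, hq, fun a ha b hb => hM a ha b hb ha⟩

end RealRAM

namespace RealRAM

open Instr Cmd Test

variable {n : ℕ} {B : Matrix (Fin n) (Fin n) ℝ}

/-- The elimination of index `p` of `F`, when it has been carried out in the first `i` rows and in
the first `j` entries of row `i`. -/
noncomputable def partialSchur (p : ℕ) (F : ℕ → ℕ → ℝ) (i j a b : ℕ) : ℝ :=
  if a < i ∨ a = i ∧ b < j then schur p F a b else F a b

theorem partialSchur_zero (p : ℕ) (F : ℕ → ℕ → ℝ) : partialSchur p F 0 0 = F := by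
  ext a b
  simp [partialSchur]

theorem partialSchur_row (p : ℕ) (F : ℕ → ℕ → ℝ) (i : ℕ) :
    partialSchur p F i p = partialSchur p F (i + 1) 0 := by
  ext a b
  unfold partialSchur schur
  split_ifs <;> first | rfl | omega

theorem partialSchur_last (p : ℕ) (F : ℕ → ℕ → ℝ) : partialSchur p F p 0 = schur p F := by
  ext a b
  unfold partialSchur schur
  split_ifs <;> first | rfl | omega

/-- `R[i, j] := R[i, j] - R[p, j] * R[6]` for `i, j, p` in `N[4], N[5], N[7]`. -/
def elimEntry : Cmd :=
  block (natAdd 9 8 5) [realLoad 8 9, realMul 8 8 6, natAdd 9 6 5, realLoad 7 9, realSub 7 7 8,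
    realStore 9 7, natAdd 5 5 2]

/-- Record the failure of a test in `N[12]`. -/
def rejectIf (c : Test) : Cmd := ite c (block (natConst 12 0) []) (block (natConst 14 0) [])

/-- Test the principal minor with indices `i` and `p` and eliminate index `p` from row `i`. -/
def elimRow : Cmd :=
  seq (block (natAdd 9 6 7) [realLoad 6 9, natAdd 9 6 4, realLoad 7 9, natAdd 9 8 4, realLoad 8 9,
      realMul 7 5 7, realMul 8 8 6])
    (seq (rejectIf (realLt 7 8))
      (seq (block (realDiv 6 6 5) [natConst 5 0])
        (seq (Cmd.while (natLt 5 7) elimEntry) (block (natAdd 4 4 2) [natAdd 6 6 1]))))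

/-- Decrease `p`, test the diagonal entry with index `p` and eliminate index `p`. -/
def elimPivot : Cmd :=
  seq (block (natSub 7 7 2) [natSub 8 8 1, natAdd 9 8 7, realLoad 5 9, natConst 4 0, natConst 6 20])
    (seq (rejectIf (realLt 5 9)) (Cmd.while (natLt 4 7) elimRow))

/-- Symmetric elimination of all indices, from the last one downwards. -/
def elimAll : Cmd := Cmd.while (natLt 13 7) elimPivot

/-- The registers and the matrix during the elimination of index `p` of `F`; `c` says that no test
has failed so far. -/
def ElimInv (K p : ℕ) (F : ℕ → ℕ → ℝ) (c : Prop) (i j : ℕ) (s : Store) : Prop :=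
  s.nat 1 = K ∧ s.nat 2 = 1 ∧ s.nat 4 = i ∧ s.nat 6 = 20 + i * K ∧ s.nat 7 = p ∧
    s.nat 8 = 20 + p * K ∧ s.nat 13 = 0 ∧ s.real 5 = F p p ∧ s.real 9 = 0 ∧
    s.queries = 2 * (K * K) ∧ (s.nat 12 = 1 ↔ c) ∧ MatrixAt K (partialSchur p F i j) s

theorem triple_elimEntry {K p i j : ℕ} {F : ℕ → ℕ → ℝ} {c : Prop} (hp : p < K) (hi : i < p)
    (hj : j < p) :
    Triple B (fun s => ElimInv K p F c i j s ∧ s.nat 5 = j ∧ s.real 6 = F i p / F p p) elimEntry 15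
      (fun s => ElimInv K p F c i (j + 1) s ∧ s.nat 5 = j + 1 ∧ s.real 6 = F i p / F p p) := by
  refine Triple.block (by rfl) ?_
  rintro s ⟨⟨h1, h2, h4, h6, h7, h8, h13, hr5, hr9, hq, hc, hM⟩, h5, hr6⟩
  have hpj : s.real (20 + p * K + j) = F p j := by
    rw [hM p hp j (by omega), partialSchur, if_neg (by omega)]
  have hij : s.real (20 + i * K + j) = F i j := by
    rw [hM i (by omega) j (by omega), partialSchur, if_neg (by omega)]
  refine ⟨⟨?_, ?_, ?_, ?_, ?_, ?_, ?_, ?_, ?_, ?_, ?_, fun a ha b hb => ?_⟩, ?_, ?_⟩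
  all_goals
    simp [Instr.apply, Store.setNat, Store.setReal, Function.update_apply, address_ne', ne_address', *]
  simp only [address_inj hb (show j < K by omega)]
  split_ifs with h
  · rw [h.1, h.2, partialSchur, if_pos (by omega), schur, if_pos (by omega)]
  · rw [hM a ha b hb]
    unfold partialSchur
    split_ifs <;> first | rfl | omega

theorem triple_rejectIf {P Q : Store → Prop} {t : Test}
    (h : ∀ s, P s → t.holds s → Q (s.setNat 12 0))
    (h' : ∀ s, P s → ¬ t.holds s → Q (s.setNat 14 0)) : Triple B P (rejectIf t) 2 Q :=
  Triple.ite (Triple.block (by rfl) fun s hs => h s hs.1 hs.2)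
    (Triple.block (by rfl) fun s hs => h' s hs.1 hs.2)

theorem ElimInv.fail {K p i j : ℕ} {F : ℕ → ℕ → ℝ} {c d : Prop} {s : Store}
    (h : ElimInv K p F c i j s) (hd : ¬ d) : ElimInv K p F (c ∧ d) i j (s.setNat 12 0) := by
  obtain ⟨h1, h2, h4, h6, h7, h8, h13, hr5, hr9, hq, hc, hM⟩ := h
  refine ⟨?_, ?_, ?_, ?_, ?_, ?_, ?_, ?_, ?_, ?_, ?_, hM⟩
  all_goals
    simp [Store.setNat, *]

theorem ElimInv.pass {K p i j : ℕ} {F : ℕ → ℕ → ℝ} {c d : Prop} {s : Store}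
    (h : ElimInv K p F c i j s) (hd : d) : ElimInv K p F (c ∧ d) i j (s.setNat 14 0) := by
  obtain ⟨h1, h2, h4, h6, h7, h8, h13, hr5, hr9, hq, hc, hM⟩ := h
  refine ⟨?_, ?_, ?_, ?_, ?_, ?_, ?_, ?_, ?_, ?_, ?_, hM⟩
  all_goals
    simp [Store.setNat, *]

theorem triple_elimRow {K p i : ℕ} {F : ℕ → ℕ → ℝ} {c : Prop} (hp : p < K) (hi : i < p) :
    Triple B (ElimInv K p F c i 0) elimRow (16 * K + 28)
      (ElimInv K p F (c ∧ F p i * F i p ≤ F p p * F i i) (i + 1) 0) := by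
  have h1 : Triple B (ElimInv K p F c i 0)
      (block (natAdd 9 6 7) [realLoad 6 9, natAdd 9 6 4, realLoad 7 9, natAdd 9 8 4, realLoad 8 9,
        realMul 7 5 7, realMul 8 8 6]) 15
      (fun s => ElimInv K p F c i 0 s ∧ s.real 6 = F i p ∧ s.real 7 = F p p * F i i ∧
        s.real 8 = F p i * F i p) := by
    refine Triple.block (by rfl) ?_
    rintro s ⟨h1, h2, h4, h6, h7, h8, h13, hr5, hr9, hq, hc, hM⟩
    have hip : s.real (20 + i * K + p) = F i p := by
      rw [hM i (by omega) p hp, partialSchur, if_neg (by omega)]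
    have hii : s.real (20 + i * K + i) = F i i := by
      rw [hM i (by omega) i (by omega), partialSchur, if_neg (by omega)]
    have hpi : s.real (20 + p * K + i) = F p i := by
      rw [hM p hp i (by omega), partialSchur, if_neg (by omega)]
    refine ⟨⟨?_, ?_, ?_, ?_, ?_, ?_, ?_, ?_, ?_, ?_, ?_, fun a ha b hb => ?_⟩, ?_, ?_, ?_⟩
    all_goals
      simp [Instr.apply, Store.setNat, Store.setReal, address_ne', *]
    exact hM a ha b hb
  have h2 : Triple B (fun s => ElimInv K p F c i 0 s ∧ s.real 6 = F i p ∧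
        s.real 7 = F p p * F i i ∧ s.real 8 = F p i * F i p) (rejectIf (realLt 7 8)) 2
      (fun s => ElimInv K p F (c ∧ F p i * F i p ≤ F p p * F i i) i 0 s ∧ s.real 6 = F i p) :=
    triple_rejectIf
      (fun s ⟨hs, h6, h7, h8⟩ ht => ⟨hs.fail (by simpa [Test.holds, h7, h8] using ht), h6⟩)
      (fun s ⟨hs, h6, h7, h8⟩ ht => ⟨hs.pass (by simpa [Test.holds, h7, h8] using ht), h6⟩)
  generalize (c ∧ F p i * F i p ≤ F p p * F i i) = d at h2 ⊢
  have h3 : Triple B (fun s => ElimInv K p F d i 0 s ∧ s.real 6 = F i p)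
      (block (realDiv 6 6 5) [natConst 5 0]) 3
      (fun s => ElimInv K p F d i 0 s ∧ s.nat 5 = 0 ∧ s.real 6 = F i p / F p p) := by
    refine Triple.block (by rfl) ?_
    rintro s ⟨⟨h1, h2, h4, h6, h7, h8, h13, hr5, hr9, hq, hc, hM⟩, hr6⟩
    refine ⟨⟨?_, ?_, ?_, ?_, ?_, ?_, ?_, ?_, ?_, ?_, ?_, fun a ha b hb => ?_⟩, ?_, ?_⟩
    all_goals
      simp [Instr.apply, Store.setNat, Store.setReal, address_ne', *]
    exact hM a ha b hb
  have h4 := Triple.while_countup (B := B) (c := natLt 5 7) (p := elimEntry) (t := 15)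
    (fun j s => ElimInv K p F d i j s ∧ s.nat 5 = j ∧ s.real 6 = F i p / F p p) p
    (fun m s _ ⟨hs, h5, _⟩ => by simp [Test.holds, hs.2.2.2.2.1, h5])
    (fun m hm => triple_elimEntry hp hi hm)
  have h5 : Triple B (fun s => ElimInv K p F d i p s ∧ s.nat 5 = p ∧ s.real 6 = F i p / F p p)
      (block (natAdd 4 4 2) [natAdd 6 6 1]) 3 (ElimInv K p F d (i + 1) 0) := by
    refine Triple.block (by rfl) ?_
    rintro s ⟨⟨h1, h2, h4, h6, h7, h8, h13, hr5, hr9, hq, hc, hM⟩, -, -⟩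
    rw [partialSchur_row] at hM
    refine ⟨?_, ?_, ?_, ?_, ?_, ?_, ?_, ?_, ?_, ?_, ?_, hM⟩
    all_goals
      simp [Instr.apply, Store.setNat, *]
    ring
  exact (h1.seq (h2.seq (h3.seq (h4.seq h5)))).consequence (fun _ h => h) (fun _ h => h) (by omega)

/-- The store when the pivots from `p` on are eliminated: the outcome of the tests so far and the
remaining matrix decide whether the form of `M` is nonnegative. -/
def PivotInv (K : ℕ) (M : ℕ → ℕ → ℝ) (p : ℕ) (s : Store) : Prop :=
  ∃ (F : ℕ → ℕ → ℝ) (c : Prop), (∀ a b, F a b = F b a) ∧ (c ∧ PsdOn p F ↔ PsdOn K M) ∧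
    s.nat 1 = K ∧ s.nat 2 = 1 ∧ s.nat 7 = p ∧ s.nat 8 = 20 + p * K ∧ s.nat 13 = 0 ∧
      s.real 9 = 0 ∧ s.queries = 2 * (K * K) ∧ (s.nat 12 = 1 ↔ c) ∧ MatrixAt K F s

theorem triple_elimPivot {K p : ℕ} {M : ℕ → ℕ → ℝ} (hp : p < K) :
    Triple B (PivotInv K M (p + 1)) elimPivot (K * (16 * K + 29) + 16) (PivotInv K M p) := by
  rintro s ⟨F, c, hF, hcM, hs⟩
  have h1 : Triple B (fun s => s.nat 1 = K ∧ s.nat 2 = 1 ∧ s.nat 7 = p + 1 ∧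
        s.nat 8 = 20 + (p + 1) * K ∧ s.nat 13 = 0 ∧ s.real 9 = 0 ∧ s.queries = 2 * (K * K) ∧
        (s.nat 12 = 1 ↔ c) ∧ MatrixAt K F s)
      (block (natSub 7 7 2)
        [natSub 8 8 1, natAdd 9 8 7, realLoad 5 9, natConst 4 0, natConst 6 20]) 11
      (ElimInv K p F c 0 0) := by
    refine Triple.block (by rfl) ?_
    rintro s ⟨h1, h2, h7, h8, h13, hr9, hq, hc, hM⟩
    have hpp := hM p hp p hp
    have h8' : s.nat 8 - K = 20 + p * K := by rw [h8, Nat.succ_mul]; omega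
    clear h8
    refine ⟨?_, ?_, ?_, ?_, ?_, ?_, ?_, ?_, ?_, ?_, ?_, fun a ha b hb => ?_⟩
    all_goals
      simp [Instr.apply, Store.setNat, Store.setReal, address_ne',
        partialSchur_zero, *]
    exact hM a ha b hb
  have h2 : Triple B (ElimInv K p F c 0 0) (rejectIf (realLt 5 9)) 2
      (ElimInv K p F (c ∧ 0 ≤ F p p) 0 0) :=
    triple_rejectIf
      (fun s hs ht => hs.fail (by simpa [Test.holds, hs.2.2.2.2.2.2.2.1, hs.2.2.2.2.2.2.2.2.1] using ht))
      (fun s hs ht => hs.pass (by simpa [Test.holds, hs.2.2.2.2.2.2.2.1, hs.2.2.2.2.2.2.2.2.1] using ht))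
  let I : ℕ → Store → Prop := fun i =>
    ElimInv K p F ((c ∧ 0 ≤ F p p) ∧ ∀ a < i, F p a * F a p ≤ F p p * F a a) i 0
  have h3 : Triple B (I 0) (Cmd.while (natLt 4 7) elimRow) (p * (16 * K + 28 + 1) + 1) (I p) := by
    refine Triple.while_countup I p (fun m s _ hs => ?_) fun m hm => ?_
    · simp [Test.holds, hs.2.2.1, hs.2.2.2.2.1]
    · convert triple_elimRow (c := _) hp hm using 2
      simp only [Nat.lt_succ_iff_lt_or_eq, or_imp, forall_and, forall_eq, and_assoc]
  have h23 : Triple B (ElimInv K p F c 0 0) (rejectIf (realLt 5 9)) 2 (I 0) := by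
    simpa [I] using h2
  obtain ⟨t, ht, s', hs', hr⟩ := (h1.seq (h23.seq h3)) s hs
  refine ⟨t, ht.trans ?_, s', ?_, hr⟩
  · have : p * (16 * K + 28 + 1) ≤ K * (16 * K + 29) := Nat.mul_le_mul_right _ hp.le
    omega
  · obtain ⟨h1, h2, h4, h6, h7, h8, h13, hr5, hr9, hq, hc, hM⟩ := hs'
    rw [partialSchur_last] at hM
    refine ⟨_, _, schur_symm hF, ?_, h1, h2, h7, h8, h13, hr9, hq, hc, hM⟩
    rw [← hcM, psdOn_succ_iff hF, and_assoc, and_assoc, and_assoc]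

theorem triple_elimAll {K : ℕ} {M : ℕ → ℕ → ℝ} :
    Triple B (PivotInv K M K) elimAll (K * (K * (16 * K + 29) + 17) + 1) (PivotInv K M 0) :=
  Triple.while_countdown (PivotInv K M) K
    (fun m s _ ⟨_, _, _, _, _, _, h7, _, h13, _⟩ => by simp [Test.holds, h7, h13])
    fun _ hm => triple_elimPivot hm

/-- Decide from the sample in `N[20], N[21], …` whether its symmetrised matrix is positive
semidefinite and write the verdict. -/
def decideSample : Cmd :=
  seq (block (natConst 3 20) [natConst 4 0])
    (seq fillMatrix
      (seq (block (natConst 12 1) [natConst 13 0, realConst 9 0, natAdd 7 1 13, natAdd 8 3 13])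
        (seq elimAll (block (natAdd 0 12 13) []))))

theorem triple_decideSample {K : ℕ} {σ : ℕ → ℕ} :
    Triple B (fun s => s.nat 1 = K ∧ s.nat 2 = 1 ∧ s.queries = 0 ∧ ∀ a < K, s.nat (20 + a) = σ a)
      decideSample (80 * (K + 1) ^ 3)
      (fun s => s.queries = 2 * (K * K) ∧ (s.nat 0 = 1 ↔ PsdOn K (sampleMatrix B σ))) := by
  have h1 : Triple B
      (fun s => s.nat 1 = K ∧ s.nat 2 = 1 ∧ s.queries = 0 ∧ ∀ a < K, s.nat (20 + a) = σ a)
      (block (natConst 3 20) [natConst 4 0]) 3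
      (fun s => ∃ j, FillInv B K σ 0 0 { s with nat := Function.update s.nat 5 j }) := by
    refine Triple.block (by rfl) ?_
    rintro s ⟨h1, h2, hq, hσ⟩
    refine ⟨0, ?_, ?_, ?_, ?_, ?_, fun a ha => ?_, ?_, fun a ha b hb hab => by omega⟩
    all_goals
      simp [Instr.apply, Store.setNat, address_ne, *]
  have h2 : Triple B
      (fun s => s.nat 1 = K ∧ s.nat 2 = 1 ∧ s.nat 3 = 20 + K * K ∧ s.queries = 2 * (K * K) ∧
        MatrixAt K (sampleMatrix B σ) s)
      (block (natConst 12 1) [natConst 13 0, realConst 9 0, natAdd 7 1 13, natAdd 8 3 13]) 9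
      (PivotInv K (sampleMatrix B σ) K) := by
    refine Triple.block (by rfl) ?_
    rintro s ⟨h1, h2, h3, hq, hM⟩
    refine ⟨sampleMatrix B σ, True, sampleMatrix_symm B σ, by simp, ?_, ?_, ?_, ?_, ?_, ?_, ?_, ?_,
      fun a ha b hb => ?_⟩
    all_goals
      simp [Instr.apply, Store.setNat, Store.setReal, address_ne', *]
    exact hM a ha b hb
  have h3 : Triple B (PivotInv K (sampleMatrix B σ) 0) (block (natAdd 0 12 13) []) 1
      (fun s => s.queries = 2 * (K * K) ∧ (s.nat 0 = 1 ↔ PsdOn K (sampleMatrix B σ))) := by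
    refine Triple.block (by rfl) ?_
    rintro s ⟨F, c, hF, hcM, h1, h2, h7, h8, h13, hr9, hq, hc, hM⟩
    rw [← hcM, ← hc]
    simp [Instr.apply, Store.setNat, *, psdOn_zero]
  refine (h1.seq (triple_fillMatrix.seq (h2.seq (triple_elimAll.seq h3)))).consequence
    (fun _ h => h) (fun _ h => h) ?_
  nlinarith [Nat.zero_le (K ^ 3), Nat.zero_le (K ^ 2)]

end RealRAM

theorem PMF.uniformOfFintype_cons_bind {α β : Type*} [Fintype α] [Nonempty α] {m : ℕ}
    (f : (Fin (m + 1) → α) → PMF β) :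
    ((PMF.uniformOfFintype α).bind fun v => (PMF.uniformOfFintype (Fin m → α)).bind fun g =>
      f (Fin.cons v g)) = (PMF.uniformOfFintype (Fin (m + 1) → α)).bind f := by
  ext y
  simp only [PMF.bind_apply, tsum_fintype, PMF.uniformOfFintype_apply, ← Finset.mul_sum]
  rw [← (Fin.consEquiv fun _ => α).sum_comp fun g => f g y, Fintype.sum_prod_type, ← mul_assoc]
  congr 1
  simp only [Fintype.card_pi, Finset.prod_const, Finset.card_univ, Fintype.card_fin, Nat.cast_pow,
    Nat.cast_mul, pow_succ]
  rw [ENNReal.mul_inv, mul_comm] <;> simp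

namespace RealRAM

open Instr Cmd Test

variable {n : ℕ} {B : Matrix (Fin n) (Fin n) ℝ}

theorem uniformBelow_eq_map [Nonempty (Fin n)] :
    uniformBelow n = (PMF.uniformOfFintype (Fin n)).map Fin.val := by
  have hn : n ≠ 0 := (Fin.pos_iff_nonempty.2 ‹_›).ne'
  ext y
  rw [uniformBelow, dif_neg hn, PMF.uniformOfFinset_apply, PMF.map_apply, tsum_fintype]
  simp only [PMF.uniformOfFintype_apply, Finset.mem_range, Finset.card_range, Fintype.card_fin]
  split_ifs with h
  · rw [Finset.sum_eq_single (⟨y, h⟩ : Fin n)]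
    · simp
    · intro b _ hb
      rw [if_neg]
      rintro rfl
      exact hb rfl
    · simp
  · symm
    refine Finset.sum_eq_zero fun i _ => if_neg ?_
    rintro rfl
    exact h i.2

/-- Put random row numbers into `N[20], N[21], …`, and their number into `N[1]`. -/
def gatherSample : Cmd :=
  Cmd.while (realLt 3 2) (seq (basic (natRand 9 0))
    (block (natStore 3 9) [natAdd 3 3 2, natAdd 1 1 2, realAdd 3 3 4]))

/-- The store when `j` row numbers have been drawn. -/
def SampleInv (n : ℕ) (β : ℝ) (j : ℕ) (s : Store) : Prop :=
  s.nat 0 = n ∧ s.nat 1 = j ∧ s.nat 2 = 1 ∧ s.nat 3 = 20 + j ∧ s.real 2 = β ∧ s.real 3 = j ∧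
    s.real 4 = 1 ∧ s.queries = 0

theorem run_gatherSample [Nonempty (Fin n)] {β : ℝ} (m : ℕ) : ∀ (j : ℕ) (s : Store),
    j + m = ⌈β⌉₊ → SampleInv n β j s →
    ∃ G : (Fin m → Fin n) → Store,
      (∀ g, SampleInv n β (j + m) (G g) ∧ (∀ a < j, (G g).nat (20 + a) = s.nat (20 + a)) ∧
        ∀ a : Fin m, (G g).nat (20 + j + a) = g a) ∧
      ∀ T K, run B (10 * m + 1 + T) ⟨gatherSample :: K, s⟩ =
        (PMF.uniformOfFintype (Fin m → Fin n)).bind fun g => run B T ⟨K, G g⟩ := by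
  induction m with
  | zero =>
    intro j s hj hs
    refine ⟨fun _ => s, fun g => ⟨hs, fun _ _ => rfl, fun a => a.elim0⟩, fun T K => ?_⟩
    rw [PMF.bind_const, mul_zero, zero_add]
    refine Reaches.of_step ?_ T
    rw [gatherSample, step, if_neg]
    have hβ : β ≤ j := by rw [add_zero] at hj; exact hj ▸ Nat.le_ceil β
    simpa [Test.holds, hs.2.2.2.2.1, hs.2.2.2.2.2.1] using hβ
  | succ m ih =>
    intro j s hj hs
    have hβ : (j : ℝ) < β := Nat.lt_ceil.1 (by omega)
    let u : ℕ → Store := fun v =>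
      ((natStore 3 9) :: [natAdd 3 3 2, natAdd 1 1 2, realAdd 3 3 4]).foldl (Instr.apply B)
        (s.setNat 9 v)
    have hu : ∀ v, SampleInv n β (j + 1) (u v) ∧
        (∀ a < j, (u v).nat (20 + a) = s.nat (20 + a)) ∧ (u v).nat (20 + j) = v := by
      intro v
      obtain ⟨h0, h1, h2, h3, hr2, hr3, hr4, hq⟩ := hs
      refine ⟨⟨?_, ?_, ?_, ?_, ?_, ?_, ?_, ?_⟩, fun a ha => ?_, ?_⟩
      all_goals
        simp [u, Instr.apply, Store.setNat, Store.setReal, Function.update_apply, address_ne,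
          (address_ne _ _).symm, *]
      all_goals omega
    choose G hG hrun using fun v : Fin n => ih (j + 1) (u v) (by omega) (hu v).1
    refine ⟨fun g => G (g 0) (Fin.tail g), fun g => ⟨?_, fun a ha => ?_, fun a => ?_⟩,
      fun T K => ?_⟩
    · have := (hG (g 0) (Fin.tail g)).1
      rwa [add_assoc, add_comm 1 m] at this
    · rw [(hG _ _).2.1 a (by omega), (hu _).2.1 a ha]
    · refine Fin.cases ?_ (fun a => ?_) a
      · rw [Fin.val_zero, add_zero, (hG _ _).2.1 j (by omega), (hu _).2.2]
      · have := (hG (g 0) (Fin.tail g)).2.2 a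
        rw [Fin.val_succ, show 20 + j + (a + 1 : ℕ) = 20 + (j + 1) + a by ring, this, Fin.tail]
    · have hstart : Reaches B ⟨gatherSample :: K, s⟩ 2
          ⟨basic (natRand 9 0) :: block (natStore 3 9) [natAdd 3 3 2, natAdd 1 1 2, realAdd 3 3 4] ::
            gatherSample :: K, s⟩ := by
        refine (Reaches.of_step ?_).trans (Reaches.seq s _ _ _)
        rw [gatherSample, step, if_pos]
        simpa [Test.holds, hs.2.2.2.2.1, hs.2.2.2.2.2.1] using hβ
      rw [show 10 * (m + 1) + 1 + T = 2 + (7 + (10 * m + 1 + T) + 1) by ring, hstart, run, step,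
        Instr.exec, hs.1, uniformBelow_eq_map, PMF.map_comp, PMF.map_comp, PMF.bind_map,
        ← PMF.uniformOfFintype_cons_bind]
      congr 1
      funext v
      simp only [Function.comp_apply, Fin.cons_zero, Fin.tail_cons]
      rw [← hrun v T K]
      exact Reaches.block [natAdd 3 3 2, natAdd 1 1 2, realAdd 3 3 4] (natStore 3 9) _ (by rfl) _ _

/-- Compute the bound `60 D² / ε² + 1` for the number of samples. -/
def initRegisters : Cmd :=
  block (natConst 2 1) [natConst 3 20, realConst 4 1, realMul 5 0 0, realMul 6 1 1, realDiv 5 5 6,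
    realConst 7 60, realMul 5 5 7, realAdd 2 5 4]

/-- Accept if and only if a random principal submatrix is positive semidefinite. -/
def tester : Cmd := seq initRegisters (seq gatherSample decideSample)

/-- The number of samples. -/
noncomputable def sampleSize (D ε : ℝ) : ℕ := ⌈D * D / (ε * ε) * 60 + 1⌉₊

theorem triple_initRegisters {D ε : ℝ} :
    Triple B (fun s => s = (init tester n D ε).store) initRegisters 17
      (SampleInv n (D * D / (ε * ε) * 60 + 1) 0) := by
  refine Triple.block (by rfl) ?_
  rintro s rfl
  refine ⟨?_, ?_, ?_, ?_, ?_, ?_, ?_, ?_⟩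
  all_goals
    simp [init, Instr.apply, Store.setNat, Store.setReal]

theorem run_tester [Nonempty (Fin n)] {D ε : ℝ} :
    ∃ (T : ℕ) (G : (Fin (sampleSize D ε) → Fin n) → Store), T ≤ 100 * (sampleSize D ε + 1) ^ 3 ∧
      (∀ g, (G g).queries = 2 * (sampleSize D ε * sampleSize D ε) ∧
        ((G g).nat 0 = 1 ↔ PsdOn (sampleSize D ε) (sampleMatrix B (extendSample g)))) ∧
      run B T (init tester n D ε) =
        (PMF.uniformOfFintype (Fin (sampleSize D ε) → Fin n)).map fun g => ⟨[], G g⟩ := by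
  obtain ⟨t, ht, s, hs, hr⟩ := triple_initRegisters (B := B) (D := D) (ε := ε) _ rfl
  generalize hK : sampleSize D ε = K
  obtain ⟨G, hG, hrun⟩ := run_gatherSample (B := B) K 0 s (by rw [zero_add, ← hK, sampleSize]) hs
  have hdec : ∀ g, ∃ t' ≤ 80 * (K + 1) ^ 3, ∃ s' : Store, (s'.queries = 2 * (K * K) ∧
      (s'.nat 0 = 1 ↔ PsdOn K (sampleMatrix B (extendSample g)))) ∧
      ∀ L, Reaches B ⟨decideSample :: L, G g⟩ t' ⟨L, s'⟩ := fun g => by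
    refine triple_decideSample (G g) ?_
    obtain ⟨⟨-, h1, h2, -, -, -, -, hq⟩, -, h⟩ := hG g
    refine ⟨by rw [h1, zero_add], h2, hq, fun a ha => ?_⟩
    rw [extendSample, dif_pos ha, ← h ⟨a, ha⟩]
  choose t' ht' s' hs' hr' using hdec
  refine ⟨1 + t + 1 + (10 * K + 1 + 80 * (K + 1) ^ 3), s', ?_, hs', ?_⟩
  · nlinarith [Nat.zero_le (K ^ 3), Nat.zero_le (K ^ 2)]
  · have h1 : Reaches B (init tester n D ε) (1 + t + 1) ⟨gatherSample :: [decideSample], s⟩ :=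
      ((Reaches.seq _ _ _ _).trans (hr _)).trans (Reaches.seq _ _ _ _)
    rw [h1, hrun, ← PMF.bind_pure_comp]
    congr 1
    funext g
    exact (hr' g []).run_eq_of_le (ht' g)

end RealRAM

theorem PMF.two_thirds_lt_map_uniformOfFintype {α β : Type*} [Fintype α] [Nonempty α] (f : α → β)
    (S : Set β) [DecidablePred fun a => f a ∉ S]
    (h : 3 * Finset.card {a | f a ∉ S} < Fintype.card α) :
    2 / 3 < ((PMF.uniformOfFintype α).map f).toOuterMeasure S := by
  classical
  rw [PMF.toOuterMeasure_map_apply, PMF.toOuterMeasure_uniformOfFintype_apply]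
  have hc : Fintype.card (f ⁻¹' S) + Finset.card {a | f a ∉ S} = Fintype.card α := by
    rw [Fintype.card_subtype, ← Finset.card_univ (α := α),
      ← Finset.card_filter_add_card_filter_not (s := Finset.univ) (fun a => f a ∈ S)]
    rfl
  rw [ENNReal.div_lt_iff (by simp) (by simp), mul_comm, ← mul_div_assoc,
    ENNReal.lt_div_iff_mul_lt (by simp) (by simp)]
  norm_cast
  omega

theorem corollary4p4 :
    ∃ (A : RealRAM.Cmd) (q t : MvPolynomial (Fin 2) ℝ),
      ∀ (n : ℕ) (D ε : ℝ) (B : Matrix (Fin n) (Fin n) ℝ),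
        0 < n → 0 < ε → (∀ i j, |B i j| ≤ D / (n : ℝ) ^ 2) →
        ∃ T : ℕ,
          (T : ℝ) ≤ MvPolynomial.eval ![D, ε⁻¹] t ∧
          (∀ c ∈ (RealRAM.run B T (RealRAM.init A n D ε)).support,
            c.Halted ∧ (c.store.queries : ℝ) ≤ MvPolynomial.eval ![D, ε⁻¹] q) ∧
          (IsFarFromPSD ε B →
            2 / 3 < (RealRAM.run B T (RealRAM.init A n D ε)).toOuterMeasure
              {c | c.Rejects}) ∧
          (IsPSD B →
            2 / 3 < (RealRAM.run B T (RealRAM.init A n D ε)).toOuterMeasure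
              {c | c.Accepts}) := by
  classical
  refine ⟨RealRAM.tester, 2 * (60 * MvPolynomial.X 0 ^ 2 * MvPolynomial.X 1 ^ 2 + 2) ^ 2,
    100 * (60 * MvPolynomial.X 0 ^ 2 * MvPolynomial.X 1 ^ 2 + 3) ^ 3, fun n D ε B hn hε hB => ?_⟩
  have : Nonempty (Fin n) := Fin.pos_iff_nonempty.1 hn
  obtain ⟨T, G, hT, hG, hrun⟩ := RealRAM.run_tester (B := B) (D := D) (ε := ε)
  have hβ : D * D / (ε * ε) * 60 = 60 * D ^ 2 * ε⁻¹ ^ 2 := by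
    field_simp
  have hsize : (RealRAM.sampleSize D ε : ℝ) ≤ 60 * D ^ 2 * ε⁻¹ ^ 2 + 2 := by
    have := Nat.ceil_lt_add_one (a := D * D / (ε * ε) * 60 + 1) (by rw [hβ]; positivity)
    rw [← RealRAM.sampleSize] at this
    linarith
  have hsize' : 60 * D ^ 2 / ε ^ 2 < RealRAM.sampleSize D ε := by
    have := Nat.le_ceil (D * D / (ε * ε) * 60 + 1)
    rw [← RealRAM.sampleSize, hβ, inv_pow, ← div_eq_mul_inv] at this
    linarith
  refine ⟨T, ?_, ?_, fun hfar => ?_, fun hpsd => ?_⟩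
  · calc (T : ℝ) ≤ 100 * ((RealRAM.sampleSize D ε : ℝ) + 1) ^ 3 := by exact_mod_cast hT
      _ ≤ 100 * (60 * D ^ 2 * ε⁻¹ ^ 2 + 3) ^ 3 :=
        mul_le_mul_of_nonneg_left (pow_le_pow_left₀ (by positivity) (by linarith) 3) (by norm_num)
      _ = _ := by simp
  · rw [hrun, PMF.support_map]
    rintro _ ⟨g, -, rfl⟩
    refine ⟨rfl, ?_⟩
    calc ((G g).queries : ℝ) = 2 * (RealRAM.sampleSize D ε : ℝ) ^ 2 := by rw [(hG g).1]; push_cast; ring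
      _ ≤ 2 * (60 * D ^ 2 * ε⁻¹ ^ 2 + 2) ^ 2 := by gcongr
      _ = _ := by simp
  · rw [hrun]
    refine PMF.two_thirds_lt_map_uniformOfFintype _ _ ?_
    have h := RealRAM.card_psdOn_sampleMatrix_lt hn hε hB hfar hsize'
    simpa [RealRAM.Config.Rejects, RealRAM.Config.Halted, (hG _).2] using h
  · rw [hrun]
    refine PMF.two_thirds_lt_map_uniformOfFintype _ _ ?_
    simp [RealRAM.Config.Accepts, RealRAM.Config.Halted, (hG _).2, RealRAM.psdOn_sampleMatrix hpsd, hn]
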